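/- A $2$-edge-coloured multigraph is a finite loopless multigraph each of whose edges has one of two colours, such that no two parallel edges have the same colour. A proper Hamiltonian path is a path containing all the vertices in which any two consecutive edges have different colours. Let $n \ge 8$ be an integer. Every $2$-edge-coloured multigraph with $n$ vertices and at least $\binom{n}{2}+\binom{n-2}{2}+1$ edges has a proper Hamiltonian path. The bound on the number of edges is tight for odd $n$: for every odd $n \ge 8$ there is a connected $2$-edge-coloured multigraph with $n$ vertices and exactly $\binom{n}{2}+\binom{n-2}{2}$ edges that has no proper Hamiltonian path. -/

import Mathlib

universe u v

/-- A loopless multigraph with vertex set `V` and edge set `E`, whose edges are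
coloured with `c` colours in such a way that no two parallel edges have the same colour. -/
structure EdgeColouredMultigraph (V : Type*) (E : Type*) (c : ℕ) where
  /-- the unordered pair of end vertices of an edge -/
  ends : E → Sym2 V
  /-- there are no loops -/
  not_isDiag : ∀ e, ¬ (ends e).IsDiag
  /-- the colour of an edge -/
  colour : E → Fin c
  /-- parallel edges of the same colour coincide -/
  eq_of_parallel : ∀ e f, ends e = ends f → colour e = colour f → e = f

namespace EdgeColouredMultigraph

/-- The underlying simple graph: two vertices are adjacent if at least one edge joins them. -/
def underlying {V E : Type*} {c : ℕ} (G : EdgeColouredMultigraph V E c) : SimpleGraph V where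
  Adj x y := ∃ e, G.ends e = s(x, y)
  symm := ⟨fun _ _ ⟨e, he⟩ => ⟨e, he.trans Sym2.eq_swap⟩⟩
  loopless := ⟨fun _ ⟨e, he⟩ => G.not_isDiag e (by rw [he]; rfl)⟩

/-- A path with `k` edges: pairwise distinct vertices `v₀, …, vₖ` and, for each `i < k`, an edge
joining `vᵢ` to `vᵢ₊₁`. -/
structure Path {V E : Type*} {c : ℕ} (G : EdgeColouredMultigraph V E c) (k : ℕ) where
  /-- the vertices, in order -/
  vert : Fin (k + 1) → V
  /-- the edges, in order -/
  edge : Fin k → E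
  vert_injective : Function.Injective vert
  ends_edge : ∀ i : Fin k, G.ends (edge i) = s(vert i.castSucc, vert i.succ)

/-- A path is Hamiltonian if it contains all vertices. -/
def Path.IsHamiltonian {V E : Type*} {c : ℕ} {G : EdgeColouredMultigraph V E c} {k : ℕ}
    (P : G.Path k) : Prop :=
  Function.Surjective P.vert

/-- A path is proper if any two consecutive edges have different colours. -/
def Path.IsProper {V E : Type*} {c : ℕ} {G : EdgeColouredMultigraph V E c} {k : ℕ}
    (P : G.Path k) : Prop :=
  ∀ i j : Fin k, (i : ℕ) + 1 = (j : ℕ) → G.colour (P.edge i) ≠ G.colour (P.edge j)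

/-- The multigraph has a proper Hamiltonian path. -/
def HasProperHamiltonianPath {V E : Type*} {c : ℕ} (G : EdgeColouredMultigraph V E c) : Prop :=
  ∃ (k : ℕ) (P : G.Path k), P.IsHamiltonian ∧ P.IsProper

end EdgeColouredMultigraph

/-!
For each colour consider the graph of missing edges; a proper Hamiltonian path alternates between
the two colours and avoids the missing edges. A cherry, that is, an alternating path `b 0`, `y`,
`b 1`, can be contracted into a single vertex: an alternating path through the remaining `n - 2`
vertices then expands to one through all `n` vertices, because in it `y` is entered and left by
different colours. The contraction destroys the missing edges of both colours at `y` and, for each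
colour `c`, those at the leaf `b c`. The number of missing edges that can be tolerated is about
`2 * n`, so by induction on `n` it suffices to find a cherry destroying about four of them, and a
vertex of large degree in the graphs of missing edges serves as its centre, unless all possible
edges of one colour at some vertex are missing; then that vertex becomes a leaf or is set aside.

For odd `n`, a proper Hamiltonian path has an even number of edges, so its end edges differ in
colour. Two vertices that meet only edges of one and the same colour would have to be its two ends.
-/

open Finset

namespace AlternatingPath

variable {V : Type*} {G : SimpleGraph V} {N : Fin 2 → SimpleGraph V} {S : Finset V}
  {c : Fin 2} {D : ℕ} {a u v y : V} {b : Fin 2 → V}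

open Classical in
/-- The number of neighbours of `u` in `S`. -/
noncomputable def degIn (G : SimpleGraph V) (S : Finset V) (u : V) : ℕ :=
  #{v ∈ S | G.Adj u v}

open Classical in
/-- The number of edges of `G` with both ends in `S`. -/
noncomputable def edgesIn (G : SimpleGraph V) (S : Finset V) : ℕ :=
  #{e ∈ S.sym2 | e ∈ G.edgeSet}

open Classical in
/-- The vertices of `S`, other than `u` itself, that are not adjacent to `u`. -/
noncomputable def nonNeighborsIn (G : SimpleGraph V) (S : Finset V) (u : V) : Finset V :=
  {v ∈ S | v ≠ u ∧ ¬ G.Adj u v}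

lemma mem_nonNeighborsIn : v ∈ nonNeighborsIn G S u ↔ v ∈ S ∧ v ≠ u ∧ ¬ G.Adj u v := by
  classical
  exact mem_filter

lemma degIn_pos : 0 < degIn G S u ↔ ∃ v ∈ S, G.Adj u v := by
  simp [degIn, card_pos, Finset.Nonempty]

lemma degIn_erase [DecidableEq V] (ha : a ∈ S) (u : V) [Decidable (G.Adj u a)] :
    degIn G S u = degIn G (S.erase a) u + if G.Adj u a then 1 else 0 := by
  classical
  rw [degIn, degIn, filter_erase]
  split_ifs with h
  · exact (card_erase_add_one (mem_filter.mpr ⟨ha, h⟩)).symm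
  · rw [erase_eq_of_notMem fun h' => h (mem_filter.mp h').2, add_zero]

lemma degIn_erase_self [DecidableEq V] (G : SimpleGraph V) (S : Finset V) (u : V) :
    degIn G (S.erase u) u = degIn G S u := by
  classical
  simp [degIn, filter_erase]

lemma edgesIn_erase [DecidableEq V] (ha : a ∈ S) :
    edgesIn G S = edgesIn G (S.erase a) + degIn G S a := by
  classical
  have without : {e ∈ {e ∈ S.sym2 | e ∈ G.edgeSet} | a ∉ e}
      = {e ∈ (S.erase a).sym2 | e ∈ G.edgeSet} := by
    ext e
    simp only [mem_filter, mem_sym2_iff, mem_erase]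
    grind
  have through : {e ∈ {e ∈ S.sym2 | e ∈ G.edgeSet} | a ∈ e}
      = image (s(a, ·)) {v ∈ S | G.Adj a v} := by
    ext e
    induction e with | h p q => ?_
    simp only [mem_filter, mk_mem_sym2_iff, SimpleGraph.mem_edgeSet, mem_image, Sym2.mem_iff]
    constructor
    · rintro ⟨⟨⟨hp, hq⟩, h⟩, rfl | rfl⟩
      exacts [⟨q, ⟨hq, h⟩, rfl⟩, ⟨p, ⟨hp, h.symm⟩, Sym2.eq_swap⟩]
    · rintro ⟨v, ⟨hv, h⟩, he⟩
      rcases Sym2.eq_iff.mp he with ⟨rfl, rfl⟩ | ⟨rfl, rfl⟩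
      exacts [⟨⟨⟨ha, hv⟩, h⟩, .inl rfl⟩, ⟨⟨⟨hv, ha⟩, h.symm⟩, .inr rfl⟩]
  have inj : Function.Injective (s(a, ·)) := fun _ _ => Sym2.congr_right.mp
  rw [edgesIn, ← card_filter_add_card_filter_not (a ∈ ·), through, without,
    card_image_of_injective _ inj, add_comm]
  rfl

lemma sum_degIn (G : SimpleGraph V) (S : Finset V) : ∑ u ∈ S, degIn G S u = 2 * edgesIn G S := by
  classical
  induction S using Finset.induction_on with
  | empty => simp [edgesIn]
  | insert a S ha ih =>
    have hmem := mem_insert_self a S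
    have hdeg : degIn G S a = ∑ u ∈ S, if G.Adj u a then 1 else 0 := by
      simp [degIn, G.adj_comm]
    simp only [sum_insert ha, edgesIn_erase hmem, degIn_erase hmem, erase_insert ha,
      sum_add_distrib, ih, G.irrefl, if_false, ← hdeg]
    ring

lemma degIn_le_edgesIn (hu : u ∈ S) : degIn G S u ≤ edgesIn G S := by
  classical
  exact edgesIn_erase (G := G) hu ▸ Nat.le_add_left _ _

lemma card_nonNeighborsIn_add_degIn (G : SimpleGraph V) (hu : u ∈ S) :
    #(nonNeighborsIn G S u) + degIn G S u + 1 = #S := by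
  classical
  have hnon : nonNeighborsIn G S u = {v ∈ S.erase u | ¬ G.Adj u v} := by
    ext v
    simp only [mem_nonNeighborsIn, mem_filter, mem_erase]
    tauto
  rw [hnon, ← degIn_erase_self, add_comm #_, degIn, card_filter_add_card_filter_not,
    card_erase_add_one hu]

lemma edgesIn_le_choose (G : SimpleGraph V) (S : Finset V) : edgesIn G S ≤ (#S).choose 2 := by
  classical
  rw [← Sym2.card_image_offDiag]
  refine card_le_card fun e he => ?_
  induction e with | h p q => ?_
  simp only [mem_filter, mk_mem_sym2_iff, SimpleGraph.mem_edgeSet] at he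
  exact mem_image.mpr ⟨(p, q), mem_offDiag.mpr ⟨he.1.1, he.1.2, he.2.ne⟩, rfl⟩

lemma edgesIn_le_choose_of_degIn_nonNeighborsIn_eq_zero
    (h : ∀ u ∈ nonNeighborsIn G S y, degIn G S u = 0) :
    edgesIn G S ≤ (degIn G S y + 1).choose 2 := by
  classical
  set C := insert y {v ∈ S | G.Adj y v}
  have hcard : #C = degIn G S y + 1 := card_insert_of_notMem (by simp)
  have mem_of_adj : ∀ p ∈ S, ∀ q ∈ S, G.Adj p q → p ∈ C := by
    intro p hp q hq hpq
    by_contra hpC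
    have hdeg := h p (mem_nonNeighborsIn.mpr (by grind))
    exact (degIn_pos.mpr ⟨q, hq, hpq⟩).ne' hdeg
  rw [← hcard]
  refine le_trans (card_le_card fun e he => ?_) (edgesIn_le_choose G C)
  induction e with | h p q => ?_
  simp only [mem_filter, mk_mem_sym2_iff, SimpleGraph.mem_edgeSet] at he ⊢
  obtain ⟨⟨hp, hq⟩, hpq⟩ := he
  exact ⟨⟨mem_of_adj p hp q hq hpq, mem_of_adj q hq p hp hpq.symm⟩, hpq⟩

lemma degIn_comap [DecidableEq V] {W : Type*} {f : W → V} {s : Finset W} (hf : Set.InjOn f s)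
    (w : W) : degIn (G.comap f) s w = degIn G (s.image f) (f w) := by
  classical
  rw [degIn, degIn, filter_image, card_image_of_injOn (hf.mono (filter_subset _ s))]
  rfl

lemma edgesIn_comap [DecidableEq V] {W : Type*} {f : W → V} {s : Finset W} (hf : Set.InjOn f s) :
    edgesIn (G.comap f) s = edgesIn G (s.image f) := by
  have h : 2 * edgesIn (G.comap f) s = 2 * edgesIn G (s.image f) := by
    simp only [← sum_degIn, degIn_comap hf, sum_image hf]
  omega

/-! ### Contracting a cherry -/

/-- `q` may follow `p` on an alternating path that avoids the edges of `N`. The second component of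
a pair is the colour of the edge by which the path leaves the vertex. -/
def Step (N : Fin 2 → SimpleGraph V) (p q : V × Fin 2) : Prop :=
  p.2 ≠ q.2 ∧ ¬ (N p.2).Adj p.1 q.1

/-- There is an alternating path with vertex set `S`, where the edges of colour `c` are the
non-edges of `N c`. The last vertex of the path also carries a colour, which is arbitrary up to
alternation. -/
def HasAlternatingPath (N : Fin 2 → SimpleGraph V) (S : Finset V) : Prop :=
  ∃ L : List (V × Fin 2), (L.map Prod.fst).Nodup ∧ (∀ v, v ∈ L.map Prod.fst ↔ v ∈ S) ∧
    L.IsChain (Step N)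

/-- An alternating path on three vertices of `S`: its centre `y` is joined to the leaf `b c` by an
edge of colour `c`, that is, by a non-edge of `N c`. -/
structure IsCherry (N : Fin 2 → SimpleGraph V) (S : Finset V) (y : V) (b : Fin 2 → V) : Prop where
  center_mem : y ∈ S
  leaf_mem : ∀ c, b c ∈ nonNeighborsIn (N c) S y
  leaf_injective : Function.Injective b

/-- The cherry with centre `y` and leaves `b` contracted into `y`. As the path `b 0`, `y`, `b 1` is
left by an edge of colour `c` at its leaf `b c.rev`, this leaf provides the adjacencies of
colour `c`. -/
def contract [DecidableEq V] (N : Fin 2 → SimpleGraph V) (y : V) (b : Fin 2 → V) (c : Fin 2) :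
    SimpleGraph V :=
  (N c).comap (Function.update id y (b c.rev))

/-- The set of vertices that survive the contraction of a cherry with leaves `b`. -/
def eraseLeaves [DecidableEq V] (S : Finset V) (b : Fin 2 → V) : Finset V :=
  (S.erase (b 0)).erase (b 1)

lemma forall_fin_two_iff_rev {p : Fin 2 → Prop} (c : Fin 2) : (∀ d, p d) ↔ p c ∧ p c.rev := by
  rw [Fin.forall_fin_two]
  fin_cases c
  exacts [Iff.rfl, and_comm]

lemma sum_fin_two_eq_add_rev (f : Fin 2 → ℕ) (c : Fin 2) : ∑ d, f d = f c + f c.rev := by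
  rw [Fin.sum_univ_two]
  fin_cases c
  exacts [rfl, add_comm _ _]

lemma rev_eq_of_ne {c d : Fin 2} (h : c ≠ d) : c.rev = d := by
  fin_cases c <;> fin_cases d <;> simp_all

lemma ne_rev (c : Fin 2) : c ≠ c.rev := by
  fin_cases c <;> simp

lemma mem_eraseLeaves [DecidableEq V] : v ∈ eraseLeaves S b ↔ v ∈ S ∧ ∀ c, v ≠ b c := by
  simp only [eraseLeaves, mem_erase, Fin.forall_fin_two]
  tauto

namespace IsCherry

lemma leaf_ne_center (h : IsCherry N S y b) (c : Fin 2) : b c ≠ y :=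
  (mem_nonNeighborsIn.mp (h.leaf_mem c)).2.1

variable [DecidableEq V]

lemma center_mem_eraseLeaves (h : IsCherry N S y b) : y ∈ eraseLeaves S b :=
  mem_eraseLeaves.mpr ⟨h.center_mem, fun c => (h.leaf_ne_center c).symm⟩

lemma eraseLeaves_ssubset (h : IsCherry N S y b) : eraseLeaves S b ⊂ S :=
  ssubset_iff_of_subset (fun _ hv => (mem_eraseLeaves.mp hv).1) |>.mpr
    ⟨b 0, (mem_nonNeighborsIn.mp (h.leaf_mem 0)).1, fun h0 => (mem_eraseLeaves.mp h0).2 0 rfl⟩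

lemma card_eraseLeaves (h : IsCherry N S y b) : #(eraseLeaves S b) = #S - 2 := by
  have mem c : b c ∈ S := (mem_nonNeighborsIn.mp (h.leaf_mem c)).1
  have hne : b 1 ≠ b 0 := h.leaf_injective.ne (by simp)
  rw [eraseLeaves, card_erase_of_mem (mem_erase.mpr ⟨hne, mem 1⟩), card_erase_of_mem (mem 0)]
  omega

lemma edgesIn_contract (h : IsCherry N S y b) (c : Fin 2) :
    edgesIn (contract N y b c) (eraseLeaves S b) + (degIn (N c) S y + degIn (N c) S (b c))
      = edgesIn (N c) S := by
  obtain ⟨leaf_mem, leaf_ne, hadj⟩ := mem_nonNeighborsIn.mp (h.leaf_mem c)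
  have hleaf : b c.rev ≠ b c := h.leaf_injective.ne (ne_rev c).symm
  have injOn : Set.InjOn (Function.update id y (b c.rev)) (eraseLeaves S b) := by
    intro u hu v hv huv
    have := (mem_eraseLeaves.mp hu).2 c.rev
    have := (mem_eraseLeaves.mp hv).2 c.rev
    simp only [Function.update_apply, id] at huv
    grind
  have image_eq :
      (eraseLeaves S b).image (Function.update id y (b c.rev)) = (S.erase y).erase (b c) := by
    ext v
    have := h.leaf_ne_center c.rev
    have := (mem_nonNeighborsIn.mp (h.leaf_mem c.rev)).1
    simp only [mem_image, mem_eraseLeaves, forall_fin_two_iff_rev c, Function.update_apply, id,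
      mem_erase]
    have := h.center_mem
    grind
  rw [contract, edgesIn_comap injOn, image_eq, edgesIn_erase h.center_mem,
    edgesIn_erase (mem_erase.mpr ⟨leaf_ne, leaf_mem⟩), ← add_assoc]
  classical
  rw [degIn_erase h.center_mem (b c), if_neg fun h' => hadj h'.symm]
  ring

end IsCherry

/-- The vertices of a path after undoing the contraction of a cherry: the centre `y`, left by colour
`d`, becomes the cherry, entered at `b d` and left at `b d.rev`. -/
def expand [DecidableEq V] (y : V) (b : Fin 2 → V) (p : V × Fin 2) : List (V × Fin 2) :=
  if p.1 = y then [(b p.2, p.2), (y, p.2.rev), (b p.2.rev, p.2)] else [p]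

lemma head?_expand [DecidableEq V] (y : V) (b : Fin 2 → V) (p : V × Fin 2) :
    (expand y b p).head? = some (Function.update id y (b p.2) p.1, p.2) := by
  unfold expand
  split_ifs with h <;> simp [h]

lemma getLast?_expand [DecidableEq V] (y : V) (b : Fin 2 → V) (p : V × Fin 2) :
    (expand y b p).getLast? = some (Function.update id y (b p.2.rev) p.1, p.2) := by
  unfold expand
  split_ifs with h <;> simp [h]

lemma expand_ne_nil [DecidableEq V] (y : V) (b : Fin 2 → V) (p : V × Fin 2) :
    expand y b p ≠ [] := by
  unfold expand
  split_ifs <;> simp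

lemma mem_map_fst_expand [DecidableEq V] {p : V × Fin 2} :
    v ∈ (expand y b p).map Prod.fst ↔ v = p.1 ∨ p.1 = y ∧ ∃ c, v = b c := by
  have : (∃ c, v = b c) ↔ v = b p.2 ∨ v = b p.2.rev := by
    rw [← not_iff_not, not_exists, forall_fin_two_iff_rev p.2, not_or]
  unfold expand
  split_ifs with h <;> grind

lemma IsCherry.isChain_expand [DecidableEq V] (h : IsCherry N S y b) (p : V × Fin 2) :
    (expand y b p).IsChain (Step N) := by
  have nonadj c := (mem_nonNeighborsIn.mp (h.leaf_mem c)).2.2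
  unfold expand
  split_ifs
  · simpa [Step, ne_rev, (ne_rev _).symm, nonadj] using fun h' => nonadj p.2 h'.symm
  · exact .singleton p

lemma IsCherry.hasAlternatingPath_of_contract [DecidableEq V] (h : IsCherry N S y b)
    (hpath : HasAlternatingPath (contract N y b) (eraseLeaves S b)) : HasAlternatingPath N S := by
  obtain ⟨L, nodup, mem, chain⟩ := hpath
  have leaf_notMem : ∀ p ∈ L, ∀ c, p.1 ≠ b c := fun p hp =>
    (mem_eraseLeaves.mp ((mem p.1).mp (List.mem_map_of_mem hp))).2
  refine ⟨L.flatMap (expand y b), ?_, fun v => ?_, ?_⟩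
  · rw [List.map_flatMap, List.nodup_flatMap]
    refine ⟨fun p _ => ?_, ?_⟩
    · have := h.leaf_injective.ne (ne_rev p.2)
      have := h.leaf_ne_center
      unfold expand
      split_ifs <;> grind
    · refine (List.pairwise_map.mp nodup).imp_of_mem fun {p q} hp hq hpq v hvp hvq => ?_
      have := leaf_notMem p hp
      have := leaf_notMem q hq
      rw [mem_map_fst_expand] at hvp hvq
      grind
  · have leaf_mem c := (mem_nonNeighborsIn.mp (h.leaf_mem c)).1
    obtain ⟨p, hp, rfl⟩ := List.mem_map.mp ((mem y).mpr h.center_mem_eraseLeaves)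
    simp only [List.mem_map, mem_eraseLeaves] at mem
    simp only [List.map_flatMap, List.mem_flatMap, mem_map_fst_expand]
    grind
  · have nil_notMem : [] ∉ L.map (expand y b) := fun hnil =>
      let ⟨p, _, hp⟩ := List.mem_map.mp hnil
      expand_ne_nil y b p hp
    rw [List.flatMap, List.isChain_flatten nil_notMem, List.isChain_map]
    refine ⟨List.forall_mem_map.mpr fun p _ => h.isChain_expand p, chain.imp fun p q hpq => ?_⟩
    obtain ⟨hne, hadj⟩ := hpq
    simp only [head?_expand, getLast?_expand, Option.mem_some_iff, forall_eq', Step]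
    exact ⟨hne, rev_eq_of_ne hne ▸ hadj⟩

/-! ### Finding a cherry -/

/-- The number of edges of `N 0` and `N 1` together from `u` to `S`. -/
noncomputable def totalDegIn (N : Fin 2 → SimpleGraph V) (S : Finset V) (u : V) : ℕ :=
  ∑ c, degIn (N c) S u

/-- Some cherry can be contracted in such a way that at least `D` edges of `N` disappear. -/
def HasCherry (N : Fin 2 → SimpleGraph V) (S : Finset V) (D : ℕ) : Prop :=
  ∃ y b, IsCherry N S y b ∧ D ≤ ∑ c, (degIn (N c) S y + degIn (N c) S (b c))

lemma HasCherry.of_leaves (hy : y ∈ S) (hu : u ∈ nonNeighborsIn (N c) S y)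
    (hv : v ∈ nonNeighborsIn (N c.rev) S y) (huv : u ≠ v)
    (hD : D ≤ totalDegIn N S y + (degIn (N c) S u + degIn (N c.rev) S v)) :
    HasCherry N S D := by
  have hne := (ne_rev c).symm
  refine ⟨y, fun d => if d = c then u else v, ⟨hy, ?_, fun d e hde => ?_⟩, ?_⟩
  · rw [forall_fin_two_iff_rev c, if_pos rfl, if_neg hne]
    exact ⟨hu, hv⟩
  · by_contra hne'
    rcases eq_or_ne d c with rfl | hdc
    · exact huv (by simpa [Ne.symm hne'] using hde)
    · have hec : e = c := by omega
      exact huv (by simpa [hdc, hec] using hde.symm)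
  · rw [sum_add_distrib, sum_fin_two_eq_add_rev (fun d => degIn (N d) S (if d = c then u else v)) c,
      if_pos rfl, if_neg hne]
    exact hD

lemma sum_totalDegIn (N : Fin 2 → SimpleGraph V) (S : Finset V) :
    ∑ u ∈ S, totalDegIn N S u = 2 * ∑ c, edgesIn (N c) S := by
  simp only [totalDegIn, sum_comm (s := S), sum_degIn, mul_sum]

lemma exists_lt_totalDegIn {k : ℕ} (h : #S * k < 2 * ∑ c, edgesIn (N c) S) :
    ∃ y ∈ S, k < totalDegIn N S y :=
  exists_lt_of_sum_lt (by rwa [sum_const, smul_eq_mul, sum_totalDegIn])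

lemma totalDegIn_add_sum_edgesIn_erase [DecidableEq V] (hy : y ∈ S) :
    totalDegIn N S y + ∑ c, edgesIn (N c) (S.erase y) = ∑ c, edgesIn (N c) S := by
  simp only [edgesIn_erase hy, sum_add_distrib, totalDegIn, add_comm]

lemma exists_ne_or_eq_singleton {α : Type*} {A B : Finset α} (hA : A.Nonempty)
    (hB : B.Nonempty) : (∃ u ∈ A, ∃ v ∈ B, u ≠ v) ∨ ∃ w, A = {w} ∧ B = {w} := by
  by_contra! h
  obtain ⟨w, hw⟩ := hA
  have hBw : ∀ v ∈ B, v = w := fun v hv => (h.1 w hw v hv).symm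
  obtain ⟨v, hv⟩ := hB
  obtain rfl := hBw v hv
  exact h.2 v (eq_singleton_iff_unique_mem.mpr ⟨hw, fun u hu => h.1 u hu v hv⟩)
    (eq_singleton_iff_unique_mem.mpr ⟨hv, hBw⟩)

lemma hasCherry_of_nonNeighborsIn_eq_singleton {w : V}
    (hT : ∑ c, edgesIn (N c) S + 4 ≤ 2 * #S) (hS : 3 ≤ #S) (hD : D < #S) (hy : y ∈ S)
    (hw : ∀ c, nonNeighborsIn (N c) S y = {w}) : HasCherry N S D := by
  classical
  have hwy c : w ∈ S ∧ w ≠ y ∧ ¬ (N c).Adj y w :=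
    mem_nonNeighborsIn.mp (hw c ▸ mem_singleton_self w)
  have degIn_y c : degIn (N c) S y + 2 = #S := by
    rw [← card_nonNeighborsIn_add_degIn (N c) hy, hw, card_singleton]
    ring
  have hsum := totalDegIn_add_sum_edgesIn_erase (N := N) hy
  have no_edge : ∀ c, ∀ u ∈ S.erase y, ∀ v ∈ S.erase y, ¬ (N c).Adj u v := by
    intro c u hu v hv huv
    have hpos := degIn_pos.mpr ⟨v, hv, huv⟩
    have hle := degIn_le_edgesIn (G := N c) hu
    rw [totalDegIn, sum_fin_two_eq_add_rev _ c, sum_fin_two_eq_add_rev _ c] at hsum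
    have := degIn_y c
    have := degIn_y c.rev
    omega
  obtain ⟨z, hz⟩ : ((S.erase y).erase w).Nonempty := by
    rw [← card_pos, card_erase_of_mem (mem_erase.mpr ⟨(hwy 0).2.1, (hwy 0).1⟩),
      card_erase_of_mem hy]
    omega
  obtain ⟨hzw, hzy, hzS⟩ : z ≠ w ∧ z ≠ y ∧ z ∈ S := by simpa only [mem_erase] using hz
  have hw_mem : w ∈ S.erase y := mem_erase.mpr ⟨(hwy 0).2.1, (hwy 0).1⟩
  have adj_yz : (N 1).Adj y z := by
    by_contra h
    exact hzw (mem_singleton.mp (hw 1 ▸ mem_nonNeighborsIn.mpr ⟨hzS, hzy, h⟩))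
  have degIn_z : 0 < degIn (N 1) S z := degIn_pos.mpr ⟨y, hy, adj_yz.symm⟩
  refine HasCherry.of_leaves (c := 0) (hwy 0).1
    (mem_nonNeighborsIn.mpr ⟨hy, (hwy 0).2.1.symm, fun h => (hwy 0).2.2 h.symm⟩)
    (mem_nonNeighborsIn.mpr ⟨hzS, hzw, no_edge _ w hw_mem z (mem_erase.mpr ⟨hzy, hzS⟩)⟩)
    hzy.symm ?_
  have := degIn_y 0
  change D ≤ _ + (_ + degIn (N 1) S z)
  omega

lemma hasCherry_of_le_totalDegIn (hT : ∑ c, edgesIn (N c) S + 4 ≤ 2 * #S) (hS : 3 ≤ #S)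
    (hD : D < #S) (hne : ∀ c, ∀ u ∈ S, (nonNeighborsIn (N c) S u).Nonempty) (hy : y ∈ S)
    (hyD : D ≤ totalDegIn N S y) : HasCherry N S D := by
  obtain ⟨u, hu, v, hv, huv⟩ | ⟨w, hw⟩ :=
    exists_ne_or_eq_singleton (hne 0 y hy) (hne (Fin.rev 0) y hy)
  · exact .of_leaves hy hu hv huv (hyD.trans (Nat.le_add_right _ _))
  · exact hasCherry_of_nonNeighborsIn_eq_singleton hT hS hD hy
      ((forall_fin_two_iff_rev 0).mpr hw)

lemma choose_two_succ (p : ℕ) : (p + 1).choose 2 = p + p.choose 2 := by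
  rw [Nat.choose_succ_succ, Nat.choose_one_right]

lemma choose_two_add_choose_two_le (p q : ℕ) :
    (p + 1).choose 2 + (q + 1).choose 2 ≤ (p + q + 1).choose 2 := by
  induction q with
  | zero => simp
  | succ q ih =>
    rw [← add_assoc p, choose_two_succ (q + 1), choose_two_succ (p + q + 1)]
    omega

lemma exists_mem_nonNeighborsIn_degIn_pos
    (h : (totalDegIn N S y + 1).choose 2 < ∑ c, edgesIn (N c) S) :
    ∃ c, ∃ u ∈ nonNeighborsIn (N c) S y, 0 < degIn (N c) S u := by
  by_contra! hzero
  have hle c := edgesIn_le_choose_of_degIn_nonNeighborsIn_eq_zero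
    fun u hu => Nat.le_zero.mp (hzero c u hu)
  refine h.not_ge ?_
  rw [totalDegIn, Fin.sum_univ_two, Fin.sum_univ_two]
  exact (add_le_add (hle 0) (hle 1)).trans (choose_two_add_choose_two_le _ _)

lemma hasCherry_totalDegIn_add_one (hne : ∀ c, ∀ u ∈ S, (nonNeighborsIn (N c) S u).Nonempty)
    (hy : y ∈ S) (hyS : totalDegIn N S y + 2 ≤ #S)
    (hchoose : (totalDegIn N S y + 1).choose 2 < ∑ c, edgesIn (N c) S) :
    HasCherry N S (totalDegIn N S y + 1) := by
  obtain ⟨c, u, hu, hu_pos⟩ := exists_mem_nonNeighborsIn_degIn_pos hchoose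
  obtain ⟨v, hv⟩ := hne c.rev y hy
  by_cases hall : ∀ v ∈ nonNeighborsIn (N c.rev) S y, v = u
  · obtain rfl := hall v hv
    have degIn_rev := card_nonNeighborsIn_add_degIn (N c.rev) hy
    rw [eq_singleton_iff_unique_mem.mpr ⟨hv, hall⟩, card_singleton] at degIn_rev
    have htotal : totalDegIn N S y = degIn (N c) S y + degIn (N c.rev) S y :=
      sum_fin_two_eq_add_rev _ c
    have degIn_y : ¬ 0 < degIn (N c) S y := by omega
    obtain ⟨t, ht, hvt⟩ := degIn_pos.mp hu_pos
    have hty : t ≠ y := by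
      rintro rfl
      exact (mem_nonNeighborsIn.mp hu).2.2 hvt.symm
    have degIn_t : 0 < degIn (N c) S t :=
      degIn_pos.mpr ⟨v, (mem_nonNeighborsIn.mp hu).1, hvt.symm⟩
    refine .of_leaves hy (mem_nonNeighborsIn.mpr ⟨ht, hty, fun h => ?_⟩) hv hvt.ne' (by omega)
    exact degIn_y (degIn_pos.mpr ⟨t, ht, h⟩)
  · push Not at hall
    obtain ⟨w, hw, hwu⟩ := hall
    exact .of_leaves hy hu hw hwu.symm (by omega)

lemma hasCherry_of_le_totalDegIn_add_one (hT : ∑ c, edgesIn (N c) S + 4 ≤ 2 * #S) (hS : 3 ≤ #S)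
    (hD : D < #S) (hne : ∀ c, ∀ u ∈ S, (nonNeighborsIn (N c) S u).Nonempty) (hy : y ∈ S)
    (hyD : D ≤ totalDegIn N S y + 1) (hchoose : D.choose 2 < ∑ c, edgesIn (N c) S) :
    HasCherry N S D := by
  obtain hle | rfl := Nat.le_succ_iff.mp hyD
  · exact hasCherry_of_le_totalDegIn hT hS hD hne hy hle
  · exact hasCherry_totalDegIn_add_one hne hy (by omega) hchoose

lemma adj_of_nonNeighborsIn_eq_empty (h : nonNeighborsIn G S y = ∅) (hu : u ∈ S) (huy : u ≠ y) :
    G.Adj y u := by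
  by_contra hadj
  exact notMem_empty u (h ▸ mem_nonNeighborsIn.mpr ⟨hu, huy, hadj⟩)

lemma degIn_mono {S' : Finset V} (h : S ⊆ S') (u : V) : degIn G S u ≤ degIn G S' u := by
  classical
  exact card_le_card (filter_subset_filter _ h)

lemma degIn_erase_lt [DecidableEq V] (ha : a ∈ S) (h : G.Adj u a) :
    degIn G (S.erase a) u < degIn G S u := by
  classical
  rw [degIn_erase ha u, if_pos h]
  exact Nat.lt_succ_self _

lemma hasCherry_of_leaf_of_nonNeighborsIn_eq_empty [DecidableEq V] (hy : y ∈ S)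
    (hdom : nonNeighborsIn (N c) S y = ∅) (hu : u ∈ nonNeighborsIn (N c.rev) S y)
    (hne : (nonNeighborsIn (N c) (S.erase y) u).Nonempty)
    (hD : D ≤ degIn (N c.rev) S y + totalDegIn N (S.erase y) u + 2) : HasCherry N S D := by
  obtain ⟨x, hx⟩ := hne
  obtain ⟨hxS, hxu, hux⟩ := mem_nonNeighborsIn.mp hx
  obtain ⟨hxy, hxS⟩ := mem_erase.mp hxS
  obtain ⟨huS, huy, hyu⟩ := mem_nonNeighborsIn.mp hu
  have degIn_x := degIn_erase_lt hy (adj_of_nonNeighborsIn_eq_empty hdom hxS hxy).symm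
  have degIn_u := degIn_erase_lt hy (adj_of_nonNeighborsIn_eq_empty hdom huS huy).symm
  have degIn_rev_u := degIn_mono (G := N c.rev) (erase_subset y S) u
  refine .of_leaves (c := c) (v := y) huS (mem_nonNeighborsIn.mpr ⟨hxS, hxu, hux⟩)
    (mem_nonNeighborsIn.mpr ⟨hy, huy.symm, fun h => hyu h.symm⟩) hxy ?_
  rw [totalDegIn, sum_fin_two_eq_add_rev _ c] at hD ⊢
  omega

lemma HasCherry.of_erase_of_nonNeighborsIn_eq_empty [DecidableEq V] (hy : y ∈ S)
    (hdom : nonNeighborsIn (N c) S y = ∅) (h : HasCherry N (S.erase y) D) :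
    HasCherry N S (D + 2) := by
  obtain ⟨z, b, ⟨z_mem, leaf_mem, inj⟩, hD⟩ := h
  have hsub := erase_subset y S
  have lt_of_mem {x : V} (hx : x ∈ S.erase y) : degIn (N c) (S.erase y) x < degIn (N c) S x :=
    degIn_erase_lt hy
      (adj_of_nonNeighborsIn_eq_empty hdom (hsub hx) (mem_erase.mp hx).1).symm
  have hleaf d := mem_nonNeighborsIn.mp (leaf_mem d)
  refine ⟨z, b, ⟨hsub z_mem, fun d => ?_, inj⟩, ?_⟩
  · exact mem_nonNeighborsIn.mpr ⟨hsub (hleaf d).1, (hleaf d).2⟩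
  · have := lt_of_mem z_mem
    have := lt_of_mem (hleaf c).1
    have := degIn_mono (G := N c.rev) hsub z
    have := degIn_mono (G := N c.rev) hsub (b c.rev)
    rw [sum_fin_two_eq_add_rev _ c] at hD ⊢
    omega

lemma nonNeighborsIn_nonempty_of_edgesIn_add_two_le (hu : u ∈ S) (h : edgesIn G S + 2 ≤ #S) :
    (nonNeighborsIn G S u).Nonempty := by
  have := card_nonNeighborsIn_add_degIn G hu
  have := degIn_le_edgesIn (G := G) hu
  rw [← card_pos]
  omega

lemma exists_le_totalDegIn_add_three (hu : u ∈ S)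
    (h : totalDegIn N S u + (#S - 1) * (D - 4) < 2 * ∑ c, edgesIn (N c) S) :
    ∃ w ∈ S, D ≤ totalDegIn N S w + 3 := by
  classical
  by_contra! hlt
  have hle : ∑ w ∈ S.erase u, totalDegIn N S w ≤ #(S.erase u) * (D - 4) :=
    sum_le_card_nsmul _ _ _ fun w hw => by have := hlt w (mem_of_mem_erase hw); omega
  rw [card_erase_of_mem hu] at hle
  rw [← sum_totalDegIn, ← add_sum_erase S _ hu] at h
  omega

lemma hasCherry_of_nonNeighborsIn_eq_empty (hT : ∑ c, edgesIn (N c) S + 4 ≤ 2 * #S)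
    (hD : D < #S) (hy : y ∈ S) (hdom : nonNeighborsIn (N c) S y = ∅)
    (hchoose : (D - 1).choose 2 + #S ≤ ∑ c, edgesIn (N c) S + 1)
    (hsum : (#S - 2) * (D - 4) + 2 * D + 2 * #S < 2 * ∑ c, edgesIn (N c) S + 8) :
    HasCherry N S D := by
  classical
  set S' := S.erase y
  have card_S' : #S' = #S - 1 := card_erase_of_mem hy
  have degIn_y : degIn (N c) S y + 1 = #S := by
    simpa [hdom] using card_nonNeighborsIn_add_degIn (N c) hy
  have hedges : degIn (N c) S y + degIn (N c.rev) S y + ∑ d, edgesIn (N d) S'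
      = ∑ d, edgesIn (N d) S := by
    rw [← totalDegIn_add_sum_edgesIn_erase hy, totalDegIn,
      sum_fin_two_eq_add_rev (fun d => degIn (N d) S y) c]
  have hne' : ∀ d, ∀ u ∈ S', (nonNeighborsIn (N d) S' u).Nonempty := fun d u hu => by
    refine nonNeighborsIn_nonempty_of_edgesIn_add_two_le hu ?_
    have := single_le_sum (f := fun d => edgesIn (N d) S') (fun _ _ => Nat.zero_le _) (mem_univ d)
    omega
  obtain ⟨u, hu⟩ : (nonNeighborsIn (N c.rev) S y).Nonempty := by
    have := card_nonNeighborsIn_add_degIn (N c.rev) hy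
    rw [← card_pos]
    omega
  obtain ⟨huS, huy, -⟩ := mem_nonNeighborsIn.mp hu
  have hu' : u ∈ S' := mem_erase.mpr ⟨huy, huS⟩
  -- Either the missing edges at `y` and `u` suffice, or they are so few that a cherry avoiding `y`
  -- exists; it destroys two edges more once `y` is restored, as all edges of colour `c` at `y` are
  -- missing.
  by_cases hend : D ≤ degIn (N c.rev) S y + totalDegIn N S' u + 2
  · exact hasCherry_of_leaf_of_nonNeighborsIn_eq_empty hy hdom hu (hne' c u hu') hend
  obtain ⟨k, rfl⟩ : ∃ k, D = k + 2 := ⟨D - 2, by omega⟩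
  obtain ⟨w, hw, hwD⟩ : ∃ w ∈ S', k + 2 ≤ totalDegIn N S' w + 3 :=
    exists_le_totalDegIn_add_three hu' (by rw [card_S', show #S - 1 - 1 = #S - 2 by omega]; omega)
  suffices HasCherry N S' k from this.of_erase_of_nonNeighborsIn_eq_empty hy hdom
  rw [Nat.add_succ_sub_one, choose_two_succ] at hchoose
  refine hasCherry_of_le_totalDegIn_add_one ?_ ?_ ?_ hne' hw ?_ ?_ <;> omega

/-! ### The induction -/

/-- An alternating path through `n` vertices survives the removal of this many edges from the
complete graphs of both colours. For `n = 5` and `n = 7` it is one less than the number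
`(n / 2 + 2).choose 2` of edges of one colour inside a set of `n / 2 + 2` vertices, whose removal
leaves no alternating path through all vertices. -/
def removableBound : ℕ → ℕ
  | 2 => 1
  | 5 => 5
  | 7 => 9
  | n => 2 * n - 4

lemma removableBound_of_ne {n : ℕ} (h2 : n ≠ 2) (h5 : n ≠ 5) (h7 : n ≠ 7) :
    removableBound n = 2 * n - 4 := by
  unfold removableBound
  split <;> omega

/-- The number of edges that have to disappear when an alternating path on three of `n` vertices is
contracted, if `T` edges are missing in total. -/
def requiredDrop (n T : ℕ) : ℕ :=
  T - removableBound (n - 2)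

section Bounds

variable {n T : ℕ}

lemma removableBound_add_four_le (hn : 3 ≤ n) : removableBound n + 4 ≤ 2 * n := by
  unfold removableBound
  split <;> omega

lemma requiredDrop_of_ten_le (hn : 10 ≤ n) : requiredDrop n T = T - (2 * n - 8) := by
  rw [requiredDrop, removableBound_of_ne] <;> omega

lemma requiredDrop_le_four (hn : 10 ≤ n) (hT : T ≤ removableBound n) : requiredDrop n T ≤ 4 := by
  rw [removableBound_of_ne (by omega) (by omega) (by omega)] at hT
  rw [requiredDrop_of_ten_le hn]
  omega

lemma requiredDrop_lt (hn : 3 ≤ n) (hT : T ≤ removableBound n) : requiredDrop n T < n := by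
  obtain hlt | hle := lt_or_ge n 10
  · revert T
    interval_cases n <;> decide
  · have := requiredDrop_le_four hle hT
    omega

lemma mul_requiredDrop_sub_two_lt (hn : 3 ≤ n) (hT : T ≤ removableBound n)
    (hpos : 0 < requiredDrop n T) : n * (requiredDrop n T - 2) < 2 * T := by
  obtain hlt | hle := lt_or_ge n 10
  · revert T
    interval_cases n <;> decide
  · have hfour := requiredDrop_le_four hle hT
    have hdrop := requiredDrop_of_ten_le hle (T := T)
    interval_cases requiredDrop n T <;> omega

lemma choose_requiredDrop_lt (hn : 3 ≤ n) (hT : T ≤ removableBound n)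
    (hpos : 0 < requiredDrop n T) : (requiredDrop n T).choose 2 < T := by
  obtain hlt | hle := lt_or_ge n 10
  · revert T
    interval_cases n <;> decide
  · have hfour := requiredDrop_le_four hle hT
    have hdrop := requiredDrop_of_ten_le hle (T := T)
    interval_cases requiredDrop n T <;> norm_num [Nat.choose] <;> omega

lemma choose_requiredDrop_pred_add_le (hn : 3 ≤ n) (hT : T ≤ removableBound n)
    (hle : n ≤ T + 1) : (requiredDrop n T - 1).choose 2 + n ≤ T + 1 := by
  obtain hlt | hge := lt_or_ge n 10
  · revert T
    interval_cases n <;> decide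
  · have hfour := requiredDrop_le_four hge hT
    have hdrop := requiredDrop_of_ten_le hge (T := T)
    interval_cases requiredDrop n T <;> norm_num <;> omega

lemma mul_requiredDrop_sub_four_add_lt (hn : 3 ≤ n) (hT : T ≤ removableBound n)
    (hle : n ≤ T + 1) :
    (n - 2) * (requiredDrop n T - 4) + 2 * requiredDrop n T + 2 * n < 2 * T + 8 := by
  obtain hlt | hge := lt_or_ge n 10
  · revert T
    interval_cases n <;> decide
  · have hfour := requiredDrop_le_four hge hT
    have hdrop := requiredDrop_of_ten_le hge (T := T)
    interval_cases requiredDrop n T <;> omega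

lemma choose_two_le_choose_two_sub_two_add (hn : 2 ≤ n) (h5 : n ≠ 5) (h7 : n ≠ 7) :
    n.choose 2 ≤ (n - 2).choose 2 + 1 + removableBound n := by
  have hbound : 2 * n - 4 ≤ removableBound n := by
    unfold removableBound
    split <;> omega
  obtain ⟨m, rfl⟩ := Nat.exists_eq_add_of_le' hn
  rw [Nat.add_sub_cancel, choose_two_succ, choose_two_succ]
  omega

end Bounds

lemma hasCherry_requiredDrop (hS : 3 ≤ #S) (hT : ∑ c, edgesIn (N c) S ≤ removableBound #S) :
    HasCherry N S (requiredDrop #S (∑ c, edgesIn (N c) S)) := by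
  have hT' : ∑ c, edgesIn (N c) S + 4 ≤ 2 * #S := by
    have := removableBound_add_four_le hS
    omega
  have hD := requiredDrop_lt hS hT
  by_cases hne : ∀ c, ∀ u ∈ S, (nonNeighborsIn (N c) S u).Nonempty
  · obtain hzero | hpos := Nat.eq_zero_or_pos (requiredDrop #S (∑ c, edgesIn (N c) S))
    · obtain ⟨y, hy⟩ : S.Nonempty := card_pos.mp (by omega)
      exact hasCherry_of_le_totalDegIn hT' hS hD hne hy (hzero ▸ Nat.zero_le _)
    · obtain ⟨y, hy, hyD⟩ := exists_lt_totalDegIn (mul_requiredDrop_sub_two_lt hS hT hpos)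
      exact hasCherry_of_le_totalDegIn_add_one hT' hS hD hne hy (by omega)
        (choose_requiredDrop_lt hS hT hpos)
  · push Not at hne
    obtain ⟨c, y, hy, hdom⟩ := hne
    have hle : #S ≤ ∑ c, edgesIn (N c) S + 1 := by
      have hdeg : degIn (N c) S y + 1 = #S := by
        simpa [hdom] using card_nonNeighborsIn_add_degIn (N c) hy
      have := degIn_le_edgesIn (G := N c) hy
      have := single_le_sum (f := fun d => edgesIn (N d) S) (fun _ _ => Nat.zero_le _) (mem_univ c)
      omega
    exact hasCherry_of_nonNeighborsIn_eq_empty hT' hD hy hdom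
      (choose_requiredDrop_pred_add_le hS hT hle) (mul_requiredDrop_sub_four_add_lt hS hT hle)

lemma hasAlternatingPath_singleton (N : Fin 2 → SimpleGraph V) (a : V) :
    HasAlternatingPath N {a} :=
  ⟨[(a, 0)], by simp, by simp, .singleton _⟩

lemma hasAlternatingPath_pair [DecidableEq V] (huv : u ≠ v) (h : ¬ (N c).Adj u v) :
    HasAlternatingPath N {u, v} :=
  ⟨[(u, c), (v, c.rev)], by simpa using huv, by simp, by simpa [Step, ne_rev] using h⟩

lemma exists_not_adj_of_sum_edgesIn_le_one [DecidableEq V]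
    (h : ∑ c, edgesIn (N c) {u, v} ≤ 1) : ∃ c, ¬ (N c).Adj u v := by
  by_contra! hadj
  have hpos c : 0 < edgesIn (N c) {u, v} :=
    (degIn_pos.mpr ⟨v, by simp, hadj c⟩).trans_le (degIn_le_edgesIn (mem_insert_self u {v}))
  have := hpos 0
  have := hpos 1
  rw [Fin.sum_univ_two] at h
  omega

theorem hasAlternatingPath_of_sum_edgesIn_le_removableBound (hS : S.Nonempty)
    (hT : ∑ c, edgesIn (N c) S ≤ removableBound #S) : HasAlternatingPath N S := by
  classical
  induction S using Finset.strongInduction generalizing N with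
  | H S ih =>
    obtain h3 | h3 := lt_or_ge #S 3
    · have := hS.card_pos
      obtain h1 | h2 : #S = 1 ∨ #S = 2 := by omega
      · obtain ⟨a, rfl⟩ := card_eq_one.mp h1
        exact hasAlternatingPath_singleton N a
      · obtain ⟨u, v, huv, rfl⟩ := card_eq_two.mp h2
        obtain ⟨c, hc⟩ := exists_not_adj_of_sum_edgesIn_le_one (h2 ▸ hT)
        exact hasAlternatingPath_pair huv hc
    · obtain ⟨y, b, hcherry, hdrop⟩ := hasCherry_requiredDrop h3 hT
      refine hcherry.hasAlternatingPath_of_contract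
        (ih _ hcherry.eraseLeaves_ssubset ⟨y, hcherry.center_mem_eraseLeaves⟩ ?_)
      have hsum : ∑ c, edgesIn (N c) S = ∑ c, edgesIn (contract N y b c) (eraseLeaves S b)
          + ∑ c, (degIn (N c) S y + degIn (N c) S (b c)) := by
        simp only [← hcherry.edgesIn_contract, sum_add_distrib]
      rw [hcherry.card_eraseLeaves]
      unfold requiredDrop at hdrop
      omega
end AlternatingPath

namespace EdgeColouredMultigraph

open AlternatingPath

/-! ### Multigraphs -/

section Missing

variable {V E : Type*} {c : ℕ} (G : EdgeColouredMultigraph V E c)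

/-- The pairs of distinct vertices that are not joined by an edge of colour `a`. -/
def missing (a : Fin c) : SimpleGraph V where
  Adj u v := u ≠ v ∧ ∀ e, G.ends e = s(u, v) → G.colour e ≠ a
  symm := ⟨fun _ _ h => ⟨h.1.symm, fun e he => h.2 e (he.trans Sym2.eq_swap)⟩⟩
  loopless := ⟨fun _ h => h.1 rfl⟩

lemma mem_edgeSet_missing {a : Fin c} {p : Sym2 V} :
    p ∈ (G.missing a).edgeSet ↔ ¬ p.IsDiag ∧ ∀ e, G.ends e = p → G.colour e ≠ a := by
  induction p with | h u v => exact Iff.rfl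

variable [Fintype V] [Fintype E]

lemma edgesIn_missing_add_card (a : Fin c) :
    edgesIn (G.missing a) univ + #{e | G.colour e = a} = (Fintype.card V).choose 2 := by
  classical
  have joined : image G.ends {e | G.colour e = a}
      = ({p | ¬ p.IsDiag ∧ ¬ ∀ e, G.ends e = p → G.colour e ≠ a} : Finset (Sym2 V)) := by
    ext p
    simp only [mem_image, mem_filter, mem_univ, true_and]
    push Not
    constructor
    · rintro ⟨e, he, rfl⟩
      exact ⟨G.not_isDiag e, e, rfl, he⟩
    · rintro ⟨-, e, rfl, he⟩
      exact ⟨e, he, rfl⟩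
  have injOn : Set.InjOn G.ends ({e | G.colour e = a} : Finset E) := fun e he f hf hef =>
    G.eq_of_parallel e f hef ((mem_filter.mp he).2.trans (mem_filter.mp hf).2.symm)
  rw [← card_image_of_injOn injOn, joined, edgesIn, sym2_univ,
    filter_congr fun p _ => G.mem_edgeSet_missing, ← filter_filter, ← filter_filter,
    card_filter_add_card_filter_not, ← Fintype.card_subtype, Sym2.card_subtype_not_diag]

lemma sum_edgesIn_missing_add_card :
    ∑ a, edgesIn (G.missing a) univ + Fintype.card E = c * (Fintype.card V).choose 2 := by
  have hcard : Fintype.card E = ∑ a, #{e | G.colour e = a} :=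
    card_eq_sum_card_fiberwise fun _ _ => mem_univ _
  simp [hcard, ← sum_add_distrib, edgesIn_missing_add_card]

end Missing

section Existence

variable {V E : Type*} [Fintype V] (G : EdgeColouredMultigraph V E 2)

lemma hasProperHamiltonianPath_of_hasAlternatingPath [Nonempty V]
    (h : HasAlternatingPath G.missing univ) : G.HasProperHamiltonianPath := by
  obtain ⟨L, nodup, mem, chain⟩ := h
  obtain ⟨k, hk⟩ : ∃ k, L.length = k + 1 := by
    refine Nat.exists_eq_succ_of_ne_zero fun h0 => ?_
    obtain ⟨v⟩ := ‹Nonempty V›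
    simpa [List.length_eq_zero_iff.mp h0] using mem v
  let vertex (i : Fin (k + 1)) : V × Fin 2 := L[i]
  have vertex_injective : Function.Injective fun i => (vertex i).1 := fun i j hij =>
    Fin.ext (nodup.getElem_inj_iff (hi := by simp [hk, i.is_le]) (hj := by simp [hk, j.is_le])
      |>.mp (by simpa [vertex] using hij))
  have step (i : Fin k) : Step G.missing (vertex i.castSucc) (vertex i.succ) :=
    List.isChain_iff_getElem.mp chain i (by omega)
  have exists_edge (i : Fin k) : ∃ e, G.ends e = s((vertex i.castSucc).1, (vertex i.succ).1) ∧
      G.colour e = (vertex i.castSucc).2 := by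
    have hne : (vertex i.castSucc).1 ≠ (vertex i.succ).1 :=
      vertex_injective.ne i.castSucc_lt_succ.ne
    simpa [missing, hne] using (step i).2
  choose edge ends_edge colour_edge using exists_edge
  refine ⟨k, ⟨fun i => (vertex i).1, edge, vertex_injective, ends_edge⟩, fun v => ?_,
    fun i j hij => ?_⟩
  · obtain ⟨i, hi, rfl⟩ := List.mem_iff_getElem.mp ((mem v).mpr (mem_univ v))
    exact ⟨⟨i, by simpa [hk] using hi⟩, by simp [vertex]⟩
  · have hsucc : i.succ = j.castSucc := Fin.ext hij
    rw [colour_edge, colour_edge, ← hsucc]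
    exact (step i).1

theorem hasProperHamiltonianPath_of_two_mul_choose_le [Nonempty V] [Fintype E]
    (h : 2 * (Fintype.card V).choose 2 ≤ Fintype.card E + removableBound (Fintype.card V)) :
    G.HasProperHamiltonianPath := by
  refine G.hasProperHamiltonianPath_of_hasAlternatingPath
    (hasAlternatingPath_of_sum_edgesIn_le_removableBound univ_nonempty ?_)
  have := G.sum_edgesIn_missing_add_card
  rw [card_univ]
  omega

end Existence

/-! ### The extremal example -/

section Extremal

variable {V E : Type*} {c k : ℕ}

lemma Path.IsProper.eq_zero_or_eq_last {G : EdgeColouredMultigraph V E c} {P : G.Path k}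
    (hP : P.IsProper) {a : Fin c} {i : Fin (k + 1)}
    (hi : ∀ e, P.vert i ∈ G.ends e → G.colour e = a) : i = 0 ∨ i = Fin.last k := by
  by_contra! h
  obtain ⟨p, rfl⟩ := Fin.exists_succ_eq.mpr h.1
  obtain ⟨q, hq⟩ := Fin.exists_castSucc_eq.mpr h.2
  refine hP p q (congrArg Fin.val hq).symm ((hi _ ?_).trans (hi _ ?_).symm)
  · exact P.ends_edge p ▸ Sym2.mem_mk_right _ _
  · exact P.ends_edge q ▸ hq ▸ Sym2.mem_mk_left _ _

lemma Path.IsProper.colour_eq_iff_even {G : EdgeColouredMultigraph V E 2} {P : G.Path (k + 1)}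
    (hP : P.IsProper) (i : Fin (k + 1)) :
    G.colour (P.edge i) = G.colour (P.edge 0) ↔ Even (i : ℕ) := by
  induction i using Fin.induction with
  | zero => simp
  | succ i ih =>
    have hne := hP i.castSucc i.succ rfl
    rw [Fin.val_succ, Nat.even_add_one, ← Fin.val_castSucc, ← ih]
    omega

lemma not_hasProperHamiltonianPath_of_odd_card [Fintype V] {G : EdgeColouredMultigraph V E 2}
    (hodd : Odd (Fintype.card V)) {a : Fin 2} {u v : V} (huv : u ≠ v)
    (hu : ∀ e, u ∈ G.ends e → G.colour e = a) (hv : ∀ e, v ∈ G.ends e → G.colour e = a) :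
    ¬ G.HasProperHamiltonianPath := by
  rintro ⟨k, P, hamiltonian, proper⟩
  have hcard : k + 1 = Fintype.card V := by
    simpa using Fintype.card_of_bijective ⟨P.vert_injective, hamiltonian⟩
  obtain ⟨i, rfl⟩ := hamiltonian u
  obtain ⟨j, rfl⟩ := hamiltonian v
  obtain _ | m := k
  · exact huv (congrArg P.vert (Subsingleton.elim (α := Fin 1) i j))
  have ends_differ (h0 : ∀ e, P.vert 0 ∈ G.ends e → G.colour e = a)
      (hlast : ∀ e, P.vert (Fin.last (m + 1)) ∈ G.ends e → G.colour e = a) : False := by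
    have first : G.colour (P.edge 0) = a := h0 _ (P.ends_edge 0 ▸ Sym2.mem_mk_left _ _)
    have last : G.colour (P.edge (Fin.last m)) = a :=
      hlast _ (P.ends_edge (Fin.last m) ▸ Sym2.mem_mk_right _ _)
    have heven := (proper.colour_eq_iff_even (Fin.last m)).mp (last.trans first.symm)
    rw [Fin.val_last] at heven
    grind
  obtain rfl | rfl := proper.eq_zero_or_eq_last hu <;>
    obtain rfl | rfl := proper.eq_zero_or_eq_last hv
  exacts [huv rfl, ends_differ hu hv, ends_differ hv hu, huv rfl]

/-- The multigraph in which colour `0` forms the complete graph on `V` and colour `1` the complete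
graph on `s`. -/
def completeWithClique (s : Finset V) :
    EdgeColouredMultigraph V ({p : Sym2 V // ¬ p.IsDiag} ⊕ {p : Sym2 s // ¬ p.IsDiag}) 2 where
  ends := Sum.elim Subtype.val fun p => p.1.map Subtype.val
  not_isDiag := by
    rintro (p | p)
    · exact p.2
    · exact (Sym2.isDiag_map Subtype.val_injective).not.mpr p.2
  colour := Sum.elim (fun _ => 0) fun _ => 1
  eq_of_parallel := by
    rintro (p | p) (q | q) hends hcolour
    · exact congrArg Sum.inl (Subtype.ext hends)
    · exact absurd hcolour zero_ne_one
    · exact absurd hcolour one_ne_zero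
    · exact congrArg Sum.inr (Subtype.ext (Sym2.map.injective Subtype.val_injective hends))

lemma underlying_completeWithClique (s : Finset V) : (completeWithClique s).underlying = ⊤ := by
  ext u v
  rw [SimpleGraph.top_adj]
  exact ⟨SimpleGraph.Adj.ne, fun huv => ⟨.inl ⟨s(u, v), huv⟩, rfl⟩⟩

lemma colour_completeWithClique_eq_zero {s : Finset V} {u : V} (hu : u ∉ s)
    (e : {p : Sym2 V // ¬ p.IsDiag} ⊕ {p : Sym2 s // ¬ p.IsDiag})
    (he : u ∈ (completeWithClique s).ends e) : (completeWithClique s).colour e = 0 := by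
  obtain p | p := e
  · rfl
  · obtain ⟨v, -, rfl⟩ := Sym2.mem_map.mp he
    exact absurd v.2 hu

theorem exists_not_hasProperHamiltonianPath {n : ℕ} (hn : 2 ≤ n) (hodd : Odd n) :
    ∃ (E : Type) (_ : Fintype E) (G : EdgeColouredMultigraph (Fin n) E 2),
      G.underlying.Connected ∧ Fintype.card E = n.choose 2 + (n - 2).choose 2 ∧
        ¬ G.HasProperHamiltonianPath := by
  obtain ⟨m, rfl⟩ := Nat.exists_eq_add_of_le' hn
  set s : Finset (Fin (m + 2)) := {0, 1}ᶜ
  refine ⟨_, inferInstance, completeWithClique s, ?_, ?_, ?_⟩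
  · rw [underlying_completeWithClique]
    exact SimpleGraph.connected_top
  · have hs : #s = m + 2 - 2 := by simp [s, card_compl]
    rw [Fintype.card_sum, Sym2.card_subtype_not_diag, Sym2.card_subtype_not_diag,
      Fintype.card_fin, Fintype.card_coe, hs]
  · exact not_hasProperHamiltonianPath_of_odd_card (by simpa using hodd) zero_ne_one
      (colour_completeWithClique_eq_zero (by simp [s]))
      (colour_completeWithClique_eq_zero (by simp [s]))

end Extremal

end EdgeColouredMultigraph

theorem theorem1_general (n : ℕ) (hn : 2 ≤ n) :
    (n ≠ 5 → n ≠ 7 →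
      ∀ (V : Type u) (E : Type v) [Fintype V] [Fintype E] (G : EdgeColouredMultigraph V E 2),
        Fintype.card V = n →
        n.choose 2 + (n - 2).choose 2 + 1 ≤ Fintype.card E →
        G.HasProperHamiltonianPath) ∧
    (Odd n →
      ∃ (E : Type) (_ : Fintype E) (G : EdgeColouredMultigraph (Fin n) E 2),
        G.underlying.Connected ∧
        Fintype.card E = n.choose 2 + (n - 2).choose 2 ∧
        ¬ G.HasProperHamiltonianPath) := by
  refine ⟨fun h5 h7 V E _ _ G hV hE => ?_,
    EdgeColouredMultigraph.exists_not_hasProperHamiltonianPath hn⟩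
  subst hV
  have : Nonempty V := Fintype.card_pos_iff.mp (by omega)
  have := AlternatingPath.choose_two_le_choose_two_sub_two_add hn h5 h7
  exact G.hasProperHamiltonianPath_of_two_mul_choose_le (by omega)

theorem theorem1 (n : ℕ) (hn : 8 ≤ n) :
    (∀ (V : Type u) (E : Type v) [Fintype V] [Fintype E] (G : EdgeColouredMultigraph V E 2),
      Fintype.card V = n →
      n.choose 2 + (n - 2).choose 2 + 1 ≤ Fintype.card E →
      G.HasProperHamiltonianPath) ∧
    (Odd n →
      ∃ (E : Type) (_ : Fintype E) (G : EdgeColouredMultigraph (Fin n) E 2),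
        G.underlying.Connected ∧
        Fintype.card E = n.choose 2 + (n - 2).choose 2 ∧
        ¬ G.HasProperHamiltonianPath) :=
  (theorem1_general n (by omega)).imp_left fun h => h (by omega) (by omega)
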